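/- \textbf{Setting.} A transmitter harvests energies $\mathcal E_i>0$ at times $\tau_i$, and a receiver harvests amounts of on-time $\Gamma_i>0$ (received energy divided by the constant power needed to be on) at times $r_i$, $i=0,1,\dots$. Each of the two lists is finite or infinite, $0=\tau_0<\tau_1<\cdots$, $0=r_0<r_1<\cdots$, with finitely many arrivals in bounded time. Put $\mathcal E(t)=\sum_{\tau_i\le t}\mathcal E_i$ and $\Gamma(t)=\sum_{r_i\le t}\Gamma_i$. The batteries are infinite. The rate function $g$ on $[0,\infty)$ is nondecreasing and concave with $g(0)=0$ and $g(p)\to\infty$ as $p\to\infty$, and $g(p)/p$ is convex and nonincreasing on $(0,\infty)$ and tends to $0$ as $p\to\infty$. Let $B_0>0$. A policy uses power $p_j\ge 0$ on $[s_j,s_{j+1}]$, $j=1,\dots,N$, where $0\le s_1\le\cdots\le s_{N+1}$; its start time is $s_1$ and its finish time is $s_{N+1}$. The receiver is on exactly while the power is nonzero. $U(t)$, $B(t)$ and $C(t)$ denote the energy used, the bits sent (at rate $g(p_j)$) and the receiver on-time up to time $t$. A policy has no breaks if all $p_j\neq0$. \emph{General problem:} minimize the finish time $T$ subject to $B(T)=B_0$,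 and $U(t)\le\mathcal E(t)$ and $C(t)\le\Gamma(t)$ for all $t\in[0,T]$. For a receiver arrival $i$ let $O_i\ge 0$ be the earliest time from which the receiver can be kept on without a break until $O_i+\Gamma(r_i)$, i.e. $t-O_i\le\Gamma(t)$ for all $t\in[O_i,O_i+\Gamma(r_i)]$; put $O_{i+1}=\infty$ if $i$ is the last receiver arrival. \emph{Problem} $\mathsf{OFF}(O_i)$: minimize the finish time $T$ subject to $B(T)=B_0$, $U(t)\le\mathcal E(t)$ and $C(t)\le\Gamma(r_i)$ for all $t\in[O_i,T]$, and $C(t)=U(t)=0$ for all $t\in[0,O_i]$. Let $i_0$ be the least receiver arrival index $i$ with $\Gamma(r_i)\,g\big(\mathcal E(t)/\Gamma(r_i)\big)\ge B_0$ for some $t$. \emph{Algorithm} $\mathsf{OFFM}$: start with $i=i_0$. Step 1: find an optimal solution $X_i$ without breaks of $\mathsf{OFF}(O_i)$ (if there are several, any of them may be found). Step 2: if the start time of $X_i$ is at most $O_{i+1}$, output $X_i$ and stop; otherwise replace $i$ by $i+1$ and go to Step 1. \textbf{Theorem.} Suppose that the general problem has a feasible policy. Then $i_0$ exists; whenever $\mathsf{OFFM}$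 arrives at Step 1, the problem $\mathsf{OFF}(O_i)$ has an optimal solution without breaks; the number of rounds is bounded over all runs of $\mathsf{OFFM}$, so that $\mathsf{OFFM}$ terminates and returns a policy; and every policy that $\mathsf{OFFM}$ can return is an optimal solution, without breaks, of the general problem. -/

import Mathlib

/-- A rate function: the bit rate `g p` achieved at transmit power `p ≥ 0`
(the values at negative powers play no role). -/
structure IsRateFunction (g : ℝ → ℝ) : Prop where
  map_zero : g 0 = 0
  monotoneOn : MonotoneOn g (Set.Ici 0)
  tendsto_atTop : Filter.Tendsto g Filter.atTop Filter.atTop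
  concaveOn : ConcaveOn ℝ (Set.Ici 0) g
  convexOn_div : ConvexOn ℝ (Set.Ioi 0) (fun p => g p / p)
  antitoneOn_div : AntitoneOn (fun p => g p / p) (Set.Ioi 0)
  tendsto_div : Filter.Tendsto (fun p => g p / p) Filter.atTop (nhds 0)

/-- A harvesting profile: a finite (`count : ℕ`) or infinite (`count = ⊤`) list of arrivals, the
`i`-th one (for `i < count`) bringing the positive amount `amount i` at time `time i`. The first
arrival takes place at time `0`, the arrival times increase, and only finitely many arrivals occur
in bounded time. For the transmitter the amounts are energies; for the receiver they are
on-times (received energy divided by the power needed to stay on). -/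
structure Arrivals where
  count : ℕ∞
  time : ℕ → ℝ
  amount : ℕ → ℝ
  count_pos : 0 < count
  time_zero : time 0 = 0
  time_lt : ∀ i j : ℕ, i < j → (j : ℕ∞) < count → time i < time j
  amount_pos : ∀ i : ℕ, (i : ℕ∞) < count → 0 < amount i
  finite_le : ∀ t : ℝ, {i : ℕ | (i : ℕ∞) < count ∧ time i ≤ t}.Finite

/-- The total amount harvested up to and including time `t`. -/
noncomputable def Arrivals.total (A : Arrivals) (t : ℝ) : ℝ :=
  ∑ i ∈ (A.finite_le t).toFinset, A.amount i

theorem Arrivals.total_mono (A : Arrivals) : Monotone A.total := by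
  intro a b hab
  unfold Arrivals.total
  apply Finset.sum_le_sum_of_subset_of_nonneg
  · intro i hi
    simp only [Set.Finite.mem_toFinset, Set.mem_ofPred_eq] at hi ⊢
    exact ⟨hi.1, hi.2.trans hab⟩
  · intro i hi _
    simp only [Set.Finite.mem_toFinset, Set.mem_ofPred_eq] at hi
    exact (A.amount_pos i hi.1).le

theorem Arrivals.total_eventually (A : Arrivals) (t : ℝ) :
    ∃ ε > 0, ∀ u, t ≤ u → u < t + ε → A.total u = A.total t := by
  classical
  have hfin := A.finite_le (t+1)
  let S := hfin.toFinset.filter (fun i => t < A.time i)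
  have : ∃ ε > 0, ε ≤ 1 ∧ ∀ i ∈ S, t + ε ≤ A.time i := by
    rcases S.eq_empty_or_nonempty with h | h
    · exact ⟨1, one_pos, le_rfl, by simp [h]⟩
    · obtain ⟨j, hj, hm⟩ := S.exists_min_image A.time h
      refine ⟨min 1 (A.time j - t), lt_min one_pos ?_, min_le_left _ _, ?_⟩
      · have := (Finset.mem_filter.1 hj).2; linarith
      · intro i hi
        have := hm i hi
        have := min_le_right 1 (A.time j - t)
        linarith
  obtain ⟨ε, h0, h1, h2⟩ := this
  refine ⟨ε, h0, fun u hu hu' => ?_⟩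
  unfold Arrivals.total
  congr 1
  ext i
  simp only [Set.Finite.mem_toFinset, Set.mem_ofPred_eq]
  constructor
  · rintro ⟨ha, hb⟩
    refine ⟨ha, ?_⟩
    by_contra hc
    have hi : i ∈ S := by
      simp only [S, Finset.mem_filter, Set.Finite.mem_toFinset, Set.mem_ofPred_eq]
      exact ⟨⟨ha, by linarith⟩, by linarith⟩
    have := h2 i hi
    linarith
  · rintro ⟨ha, hb⟩; exact ⟨ha, by linarith⟩

theorem Arrivals.time_nonneg (A : Arrivals) (i : ℕ) (hi : (i : ℕ∞) < A.count) : 0 ≤ A.time i := by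
  rcases Nat.eq_zero_or_pos i with h | h
  · rw [h, A.time_zero]
  · rw [← A.time_zero]; exact (A.time_lt 0 i h hi).le

/-- A transmission policy: power `p i` is used from time `s i` to time `s (i + 1)`, for the `N`
indices `i = 0, …, N - 1`. The receiver is on exactly while the power is nonzero. -/
structure Policy where
  N : ℕ
  p : Fin N → ℝ
  s : Fin (N + 1) → ℝ
  p_nonneg : ∀ i, 0 ≤ p i
  s_nonneg : ∀ i, 0 ≤ s i
  s_mono : Monotone s

namespace Policy

/-- The start time of the policy. -/
def start (P : Policy) : ℝ := P.s 0

/-- The finish time of the policy. -/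
def finish (P : Policy) : ℝ := P.s (Fin.last P.N)

/-- The length of the part of the `i`-th piece of the policy that lies before time `t`. -/
noncomputable def elapsed (P : Policy) (i : Fin P.N) (t : ℝ) : ℝ :=
  min t (P.s i.succ) - min t (P.s i.castSucc)

/-- The energy `U t` used by the transmitter up to time `t`. -/
noncomputable def energy (P : Policy) (t : ℝ) : ℝ :=
  ∑ i, P.p i * P.elapsed i t

/-- The number of bits `B t` sent up to time `t`. -/
noncomputable def bits (P : Policy) (g : ℝ → ℝ) (t : ℝ) : ℝ :=
  ∑ i, g (P.p i) * P.elapsed i t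

open Classical in
/-- The time `C t` for which the receiver has been on up to time `t`. -/
noncomputable def onTime (P : Policy) (t : ℝ) : ℝ :=
  ∑ i, if P.p i ≠ 0 then P.elapsed i t else 0

/-- The receiver stays on from the start to the finish of the policy. -/
def NoBreaks (P : Policy) : Prop := ∀ i, P.p i ≠ 0

/-- `P` is a solution of the problem of minimizing the finish time subject to `F`. -/
def IsOptimal (F : Policy → Prop) (P : Policy) : Prop :=
  F P ∧ ∀ Q, F Q → P.finish ≤ Q.finish

end Policy

/-- The constraints of the general problem: send `B₀` bits, with the energy arrivals `tx` at the
transmitter and the on-time arrivals `rx` at the receiver, with infinite batteries. -/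
def GeneralFeasible (tx rx : Arrivals) (g : ℝ → ℝ) (B₀ : ℝ) (P : Policy) : Prop :=
  P.bits g P.finish = B₀ ∧
  (∀ t ∈ Set.Icc 0 P.finish, P.energy t ≤ tx.total t) ∧
  (∀ t ∈ Set.Icc 0 P.finish, P.onTime t ≤ rx.total t)

/-- The total on-time harvested by the receiver up to its `i`-th arrival. -/
noncomputable def budget (rx : Arrivals) (i : ℕ) : ℝ := rx.total (rx.time i)

/-- The times `O ≥ 0` from which the receiver can be kept on, without any break, until it has
spent the total on-time harvested up to its `i`-th arrival. -/
def originSet (rx : Arrivals) (i : ℕ) : Set ℝ :=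
  {O | 0 ≤ O ∧ ∀ t ∈ Set.Icc O (O + budget rx i), t - O ≤ rx.total t}

/-- The earliest such time, `O_i`. -/
noncomputable def origin (rx : Arrivals) (i : ℕ) : ℝ := sInf (originSet rx i)

/-- `O_i` is attained, so it is indeed the earliest such time. -/
theorem isLeast_origin (rx : Arrivals) (i : ℕ) (hi : (i : ℕ∞) < rx.count) :
    IsLeast (originSet rx i) (origin rx i) := by
  have hb : BddBelow (originSet rx i) := ⟨0, fun x hx => hx.1⟩
  have hne : (originSet rx i).Nonempty := by
    refine ⟨rx.time i, rx.time_nonneg i hi, fun t ht => ?_⟩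
    have := rx.total_mono ht.1
    have h2 := ht.2
    unfold budget at h2
    linarith
  refine ⟨⟨le_csInf hne fun x hx => hx.1, fun t ht => ?_⟩, fun x hx => csInf_le hb hx⟩
  obtain ⟨ε, h0, h1⟩ := rx.total_eventually t
  obtain ⟨x, hx, hlt⟩ := exists_lt_of_csInf_lt hne (show sInf (originSet rx i) < origin rx i + ε by
    unfold origin; linarith)
  have hox : origin rx i ≤ x := csInf_le hb hx
  have := hx.2 (t + (x - origin rx i)) ⟨by linarith [ht.1], by linarith [ht.2]⟩
  rw [h1 _ (by linarith) (by linarith)] at this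
  linarith

/-- The constraints of the problem `OFF(O_i)` with a single receiver arrival: the whole on-time
harvested up to the `i`-th receiver arrival becomes available at time `O_i`, and nothing is sent
before `O_i`. -/
def SingleFeasible (tx rx : Arrivals) (g : ℝ → ℝ) (B₀ : ℝ) (i : ℕ) (P : Policy) : Prop :=
  P.bits g P.finish = B₀ ∧
  (∀ t ∈ Set.Icc (origin rx i) P.finish, P.energy t ≤ tx.total t) ∧
  (∀ t ∈ Set.Icc (origin rx i) P.finish, P.onTime t ≤ budget rx i) ∧
  (∀ t ∈ Set.Icc 0 (origin rx i), P.onTime t = 0 ∧ P.energy t = 0)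

/-- `P` is a solution, without breaks, of the problem `OFF(O_i)`. -/
def SolvesOFF (tx rx : Arrivals) (g : ℝ → ℝ) (B₀ : ℝ) (i : ℕ) (P : Policy) : Prop :=
  P.IsOptimal (SingleFeasible tx rx g B₀ i) ∧ P.NoBreaks

/-- `i₀` is the first receiver arrival such that the on-time harvested up to it is eventually
sufficient for sending `B₀` bits. -/
def IsInitialIndex (tx rx : Arrivals) (g : ℝ → ℝ) (B₀ : ℝ) (i₀ : ℕ) : Prop :=
  IsLeast {i : ℕ | (i : ℕ∞) < rx.count ∧
    ∃ t : ℝ, B₀ ≤ budget rx i * g (tx.total t / budget rx i)} i₀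

/-- The test of Step 2 of `OFFM`: the start time of `P` is at most `O_{i+1}`, where
`O_{i+1} = ∞` if the `i`-th receiver arrival is the last one. -/
def Accepts (rx : Arrivals) (i : ℕ) (P : Policy) : Prop :=
  ((i + 1 : ℕ) : ℕ∞) < rx.count → P.start ≤ origin rx (i + 1)

/-- Some run of `OFFM` arrives at Step 1 with the index `i`. The algorithm begins with `i = i₀`.
Step 1 finds a solution `X` of `OFF(O_i)`; if Step 2 does not accept it, then `OFFM` goes back to
Step 1 with `i + 1`. Any solution may be found in Step 1. -/
inductive OFFMReaches (tx rx : Arrivals) (g : ℝ → ℝ) (B₀ : ℝ) : ℕ → Prop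
  | init (i₀ : ℕ) : IsInitialIndex tx rx g B₀ i₀ → OFFMReaches tx rx g B₀ i₀
  | next (i : ℕ) (X : Policy) : OFFMReaches tx rx g B₀ i → SolvesOFF tx rx g B₀ i X →
      ¬ Accepts rx i X → OFFMReaches tx rx g B₀ (i + 1)

/-- Some run of `OFFM` outputs the policy `X`. -/
def OFFMReturns (tx rx : Arrivals) (g : ℝ → ℝ) (B₀ : ℝ) (X : Policy) : Prop :=
  ∃ i, OFFMReaches tx rx g B₀ i ∧ SolvesOFF tx rx g B₀ i X ∧ Accepts rx i X

/-! The core is an optimality statement for policies without breaks. A concave `g` lies below an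
affine majorant touching it at any power `q > 0`, so the bits sent in a period are at most the
intercept times the on-time plus the slope times the energy (`bits_sub_le`). On `[s, T]`, the
taut-string policy, which repeatedly follows the steepest line below the harvested energy, makes
these bounds tight and beats every competitor (`exists_maximal_policy`). A policy with breaks
becomes a competitor once its breaks are moved to the front, which only delays the use of energy.
Leftover idle time costs bits strictly: `g p / p` strictly decreases, so the intercepts are positive
(`exists_dominating_policy`). Hence a feasible `OFF(O_i)` has a solution without breaks, and such a
solution starting after `O_i` uses its whole on-time.

Let a feasible policy of the general problem finish at `T` with on-time `C`, and let `k` be the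
first arrival with `Γ(r_k) ≥ C`. The receiver can be kept on from `T - C` to `T`, so `O_k ≤ T - C`,
and some policy feasible in `OFF(O_k)` finishes by `T`. Conversely, solutions of `OFF(O_i)` without
breaks are feasible in the general problem. A rejected `X_i` is feasible in `OFF(O_{i+1})`, so the
minimum finish time never increases during a run; this settles `k ≤ i` for an accepted `X_i`. If `k
> i`, then `X_i` starts by `O_{i+1} ≤ O_k ≤ T - C` and lasts at most `Γ(r_i) < C`, so it finishes
before `T`. The rounds are bounded because a rejected `X_i` finishes after `O_i + Γ(r_i) ≥ r_i`,
while its finish time is bounded by that of any policy feasible in the first round. -/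

namespace Policy

/-! ### Energy, bits and on-time of a policy -/

theorem sum_succ_sub_castSucc {N : ℕ} (f : Fin (N + 1) → ℝ) :
    ∑ i : Fin N, (f i.succ - f i.castSucc) = f (Fin.last N) - f 0 := by
  induction N with
  | zero => simp
  | succ n ih =>
    rw [Fin.sum_univ_succ]
    have := ih (fun i => f i.succ)
    simp only [Fin.succ_castSucc] at this
    rw [this]
    simp

theorem start_le_finish (P : Policy) : P.start ≤ P.finish := P.s_mono (Fin.zero_le _)

theorem start_nonneg (P : Policy) : 0 ≤ P.start := P.s_nonneg 0

theorem finish_nonneg (P : Policy) : 0 ≤ P.finish := P.s_nonneg _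

theorem elapsed_mono (P : Policy) (i : Fin P.N) : Monotone (P.elapsed i) := by
  intro t u h
  have := P.s_mono (Fin.castSucc_le_succ i)
  unfold elapsed
  grind

theorem elapsed_of_nonpos (P : Policy) (i : Fin P.N) {t : ℝ} (ht : t ≤ 0) :
    P.elapsed i t = 0 := by
  have h1 := P.s_nonneg i.castSucc
  have h2 := P.s_nonneg i.succ
  simp [elapsed, min_eq_left (ht.trans h1), min_eq_left (ht.trans h2)]

theorem sum_elapsed (P : Policy) (t : ℝ) :
    ∑ i, P.elapsed i t = min t P.finish - min t P.start :=
  sum_succ_sub_castSucc (fun i => min t (P.s i))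

theorem NoBreaks.onTime_eq {P : Policy} (h : P.NoBreaks) (t : ℝ) :
    P.onTime t = min t P.finish - min t P.start := by
  rw [← sum_elapsed]
  exact Finset.sum_congr rfl fun i _ => if_pos (h i)

theorem NoBreaks.onTime_finish {P : Policy} (h : P.NoBreaks) :
    P.onTime P.finish = P.finish - P.start := by
  rw [h.onTime_eq, min_self, min_eq_right P.start_le_finish]

theorem onTime_mono (P : Policy) : Monotone P.onTime := by
  intro t u h
  refine Finset.sum_le_sum fun i _ => ?_
  have := P.elapsed_mono i h
  split_ifs <;> simp [this]

theorem energy_mono (P : Policy) : Monotone P.energy := fun _ _ h =>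
  Finset.sum_le_sum fun i _ => mul_le_mul_of_nonneg_left (P.elapsed_mono i h) (P.p_nonneg i)

theorem onTime_zero (P : Policy) : P.onTime 0 = 0 := by
  simp [onTime, P.elapsed_of_nonpos _ le_rfl]

theorem energy_zero (P : Policy) : P.energy 0 = 0 := by
  simp [energy, P.elapsed_of_nonpos _ le_rfl]

theorem bits_zero (P : Policy) (g : ℝ → ℝ) : P.bits g 0 = 0 := by
  simp [bits, P.elapsed_of_nonpos _ le_rfl]

theorem elapsed_of_le_start (P : Policy) (i : Fin P.N) {t : ℝ} (ht : t ≤ P.start) :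
    P.elapsed i t = 0 := by
  have h1 := P.s_mono (Fin.zero_le i.castSucc)
  have h2 := P.s_mono (Fin.zero_le i.succ)
  simp only [start] at ht
  simp [elapsed, min_eq_left (ht.trans h1), min_eq_left (ht.trans h2)]

theorem energy_of_le_start (P : Policy) {t : ℝ} (ht : t ≤ P.start) : P.energy t = 0 := by
  simp [energy, P.elapsed_of_le_start _ ht]

theorem onTime_of_le_start (P : Policy) {t : ℝ} (ht : t ≤ P.start) : P.onTime t = 0 := by
  simp [onTime, P.elapsed_of_le_start _ ht]

theorem bits_of_le_start (P : Policy) (g : ℝ → ℝ) {t : ℝ} (ht : t ≤ P.start) :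
    P.bits g t = 0 := by
  simp [bits, P.elapsed_of_le_start _ ht]

theorem continuous_elapsed (P : Policy) (i : Fin P.N) : Continuous (P.elapsed i) := by
  unfold elapsed; fun_prop

theorem continuous_energy (P : Policy) : Continuous P.energy :=
  continuous_finsetSum _ fun i _ => continuous_const.mul (P.continuous_elapsed i)

theorem continuous_bits (P : Policy) (g : ℝ → ℝ) : Continuous (P.bits g) :=
  continuous_finsetSum _ fun i _ => continuous_const.mul (P.continuous_elapsed i)

theorem continuous_onTime (P : Policy) : Continuous P.onTime := by
  refine continuous_finsetSum _ fun i _ => ?_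
  by_cases h : P.p i ≠ 0
  · simpa [h] using P.continuous_elapsed i
  · simpa [h] using continuous_const

theorem onTime_sub_le (P : Policy) {t u : ℝ} (h : t ≤ u) :
    P.onTime u - P.onTime t ≤ u - t := by
  calc P.onTime u - P.onTime t ≤ ∑ i, (P.elapsed i u - P.elapsed i t) := by
        unfold onTime
        rw [← Finset.sum_sub_distrib]
        refine Finset.sum_le_sum fun i _ => ?_
        have := P.elapsed_mono i h
        split_ifs <;> simp [this]
    _ = (min u P.finish - min u P.start) - (min t P.finish - min t P.start) := by
        rw [Finset.sum_sub_distrib, sum_elapsed, sum_elapsed]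
    _ ≤ u - t := by
        have := P.start_le_finish
        grind

/-- The bits sent between two times are bounded by means of an affine majorant of `g`. -/
theorem bits_sub_le (P : Policy) {g : ℝ → ℝ} {q l : ℝ} (hg0 : g 0 = 0)
    (hl : ∀ p, 0 ≤ p → g p ≤ g q + l * (p - q)) {t u : ℝ} (h : t ≤ u) :
    P.bits g u - P.bits g t ≤
      (g q - l * q) * (P.onTime u - P.onTime t) + l * (P.energy u - P.energy t) := by
  unfold bits onTime energy
  simp only [← Finset.sum_sub_distrib, Finset.mul_sum, ← Finset.sum_add_distrib]
  refine Finset.sum_le_sum fun i _ => ?_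
  have h1 := sub_nonneg.2 (P.elapsed_mono i h)
  have h2 := mul_le_mul_of_nonneg_right (hl _ (P.p_nonneg i)) h1
  -- The intercept is charged for on-time only: a piece of power zero contributes nothing to either
  -- side, since `g 0 = 0`.
  by_cases hp : P.p i = 0
  · simp [hp, hg0]
  · simp only [ne_eq, hp, not_false_eq_true, if_true]
    linarith

/-! ### Cutting and extending policies -/

/-- The policy that follows `P` until time `T` and then finishes. -/
def cut (P : Policy) (T : ℝ) (hT : 0 ≤ T) : Policy where
  N := P.N
  p := P.p
  s i := min (P.s i) T
  p_nonneg := P.p_nonneg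
  s_nonneg i := le_min (P.s_nonneg i) hT
  s_mono _ _ h := min_le_min_right _ (P.s_mono h)

theorem cut_elapsed (P : Policy) (T : ℝ) (hT : 0 ≤ T) (i : Fin P.N) (t : ℝ) :
    (P.cut T hT).elapsed i t = P.elapsed i (min t T) := by
  simp only [elapsed, cut]
  grind

theorem cut_energy (P : Policy) (T : ℝ) (hT : 0 ≤ T) (t : ℝ) :
    (P.cut T hT).energy t = P.energy (min t T) :=
  Finset.sum_congr rfl fun i _ => congrArg (P.p i * ·) (P.cut_elapsed T hT i t)

theorem cut_bits (P : Policy) (g : ℝ → ℝ) (T : ℝ) (hT : 0 ≤ T) (t : ℝ) :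
    (P.cut T hT).bits g t = P.bits g (min t T) :=
  Finset.sum_congr rfl fun i _ => congrArg (g (P.p i) * ·) (P.cut_elapsed T hT i t)

theorem cut_start (P : Policy) (T : ℝ) (hT : 0 ≤ T) : (P.cut T hT).start = min P.start T := rfl

theorem cut_finish (P : Policy) (T : ℝ) (hT : 0 ≤ T) : (P.cut T hT).finish = min P.finish T := rfl

theorem NoBreaks.cut {P : Policy} (h : P.NoBreaks) (T : ℝ) (hT : 0 ≤ T) :
    (P.cut T hT).NoBreaks := h

/-- The empty policy at time `s`. -/
def empty (s : ℝ) (hs : 0 ≤ s) : Policy where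
  N := 0
  p := Fin.elim0
  s _ := s
  p_nonneg i := i.elim0
  s_nonneg _ := hs
  s_mono _ _ _ := le_rfl

theorem empty_energy (s : ℝ) (hs : 0 ≤ s) (t : ℝ) : (empty s hs).energy t = 0 :=
  Fin.sum_univ_zero _

theorem empty_bits (g : ℝ → ℝ) (s : ℝ) (hs : 0 ≤ s) (t : ℝ) : (empty s hs).bits g t = 0 :=
  Fin.sum_univ_zero _

theorem empty_noBreaks (s : ℝ) (hs : 0 ≤ s) : (empty s hs).NoBreaks := fun i => i.elim0

/-- The policy that uses power `q` from time `s` to the start of `P` and then follows `P`. -/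
def cons (q s : ℝ) (P : Policy) (hq : 0 ≤ q) (hs : 0 ≤ s) (hsP : s ≤ P.start) : Policy where
  N := P.N + 1
  p := Fin.cons q P.p
  s := Fin.cons s P.s
  p_nonneg i := by
    refine Fin.cases ?_ (fun j => ?_) i
    · simpa using hq
    · simpa using P.p_nonneg j
  s_nonneg i := by
    refine Fin.cases ?_ (fun j => ?_) i
    · simpa using hs
    · simpa using P.s_nonneg j
  s_mono i j := by
    refine Fin.cases (fun _ => ?_) (fun i' => ?_) i
    · refine Fin.cases le_rfl (fun j' => ?_) j
      simpa using hsP.trans (P.s_mono (Fin.zero_le j'))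
    · refine Fin.cases (fun h => ?_) (fun j' h => ?_) j
      · simp at h
      · simpa using P.s_mono (Fin.succ_le_succ_iff.1 h)

section cons

variable (q s : ℝ) (P : Policy) (hq : 0 ≤ q) (hs : 0 ≤ s) (hsP : s ≤ P.start)

theorem cons_energy (t : ℝ) :
    (cons q s P hq hs hsP).energy t = q * (min t P.start - min t s) + P.energy t :=
  Fin.sum_univ_succ (n := P.N) _

theorem cons_bits (g : ℝ → ℝ) (t : ℝ) :
    (cons q s P hq hs hsP).bits g t = g q * (min t P.start - min t s) + P.bits g t :=
  Fin.sum_univ_succ (n := P.N) _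

theorem NoBreaks.cons {P : Policy} (h : P.NoBreaks) (hsP : s ≤ P.start) (hq0 : q ≠ 0) :
    (Policy.cons q s P hq hs hsP).NoBreaks := fun i => by
  revert i
  exact Fin.cases hq0 h

end cons

/-- A policy can be shortened so that it sends any smaller number of bits. -/
theorem exists_cut (P : Policy) (g : ℝ → ℝ) {B : ℝ} (hB0 : 0 ≤ B) (hB : B ≤ P.bits g P.finish) :
    ∃ T, P.start ≤ T ∧ T ≤ P.finish ∧ P.bits g T = B := by
  obtain ⟨T, hT, h⟩ := intermediate_value_Icc P.start_le_finish
    (P.continuous_bits g).continuousOn ⟨by rwa [P.bits_of_le_start g le_rfl], hB⟩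
  exact ⟨T, hT.1, hT.2, h⟩

end Policy

/-! ### Affine majorants of the rate function -/

namespace IsRateFunction

variable {g : ℝ → ℝ}

theorem nonneg (hg : IsRateFunction g) {p : ℝ} (hp : 0 ≤ p) : 0 ≤ g p := by
  rw [← hg.map_zero]
  exact hg.monotoneOn (Set.mem_Ici.2 le_rfl) hp hp

/-- At every positive power, `g` has an affine majorant of nonnegative slope touching it there. -/
theorem exists_supergradient (hg : IsRateFunction g) {q : ℝ} (hq : 0 < q) :
    ∃ l, 0 ≤ l ∧ ∀ p, 0 ≤ p → g p ≤ g q + l * (p - q) := by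
  -- The slope is the infimum of the chord slopes to the left of `q`; by concavity every chord slope
  -- to the right is at most each of these.
  set S : Set ℝ := (fun p => (g q - g p) / (q - p)) '' Set.Ico 0 q with hS
  have hne : S.Nonempty := ⟨_, 0, ⟨le_rfl, hq⟩, rfl⟩
  have h0 : ∀ x ∈ S, 0 ≤ x := by
    rintro _ ⟨p, hp, rfl⟩
    exact div_nonneg (sub_nonneg.2 (hg.monotoneOn hp.1 hq.le hp.2.le)) (sub_nonneg.2 hp.2.le)
  refine ⟨sInf S, le_csInf hne h0, fun p hp => ?_⟩
  rcases lt_trichotomy p q with h | rfl | h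
  · have h1 : sInf S ≤ (g q - g p) / (q - p) := csInf_le ⟨0, h0⟩ ⟨p, ⟨hp, h⟩, rfl⟩
    rw [le_div_iff₀ (sub_pos.2 h)] at h1
    linarith
  · simp
  · have h1 : (g p - g q) / (p - q) ≤ sInf S := by
      refine le_csInf hne ?_
      rintro _ ⟨r, hr, rfl⟩
      exact hg.concaveOn.slope_anti_adjacent hr.1 hp hr.2 h
    rw [div_le_iff₀ (sub_pos.2 h)] at h1
    linarith

/-- The bits sent per unit of energy strictly decrease with the power. -/
theorem div_lt_div (hg : IsRateFunction g) {r q : ℝ} (hr : 0 < r) (hrq : r < q) :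
    g q / q < g r / r := by
  have hq : 0 < q := hr.trans hrq
  refine lt_of_le_of_ne (hg.antitoneOn_div hr hq hrq.le) fun heq => ?_
  -- Equality at `r < q` would, by convexity, keep `g p / p` from decreasing after `q`; it would be
  -- constant there, hence equal to its limit `0`, although `g` becomes positive.
  have hconst : ∀ p, q < p → g p / p = g q / q := fun p hp => by
    refine le_antisymm (hg.antitoneOn_div hq (hq.trans hp) hp.le) ?_
    have := hg.convexOn_div.slope_mono_adjacent hr (hq.trans hp) hrq hp
    rw [heq, sub_self, zero_div, le_div_iff₀ (sub_pos.2 hp)] at this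
    linarith
  have hlim : g q / q = 0 := by
    refine tendsto_nhds_unique (tendsto_const_nhds.congr' ?_) hg.tendsto_div
    filter_upwards [Filter.eventually_gt_atTop q] with p hp using (hconst p hp).symm
  obtain ⟨p, h1, h2⟩ := ((Filter.eventually_gt_atTop q).and
    (hg.tendsto_atTop.eventually_gt_atTop 0)).exists
  have := div_pos h2 (hq.trans h1)
  rw [hconst p h1, hlim] at this
  exact this.false

/-- The intercepts of the affine majorants touching `g` at powers at least `q₀` are bounded below
by a positive constant. -/
theorem exists_pos_le_intercept (hg : IsRateFunction g) {q₀ : ℝ} (hq₀ : 0 < q₀) :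
    ∃ κ, 0 < κ ∧ ∀ q l, q₀ ≤ q → (∀ p, 0 ≤ p → g p ≤ g q + l * (p - q)) → κ ≤ g q - l * q := by
  have h := hg.div_lt_div (half_pos hq₀) (half_lt_self hq₀)
  rw [div_lt_div_iff₀ hq₀ (half_pos hq₀)] at h
  -- This is the intercept of the chord of `g` through `q₀ / 2` and `q₀`. A majorant touching at `q
  -- ≥ q₀` lies above the chord at `q₀` and is no steeper, so its intercept is no smaller.
  refine ⟨2 * g (q₀ / 2) - g q₀, by nlinarith, fun q l hq hl => ?_⟩
  have h1 := hl q₀ hq₀.le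
  have h0 := hg.nonneg hq₀.le
  have h2 : l * (q₀ / 2) ≤ g q₀ - g (q₀ / 2) := by
    rcases hq.eq_or_lt with rfl | hlt
    · have := hl (q₀ / 2) (by linarith); linarith
    · have h3 := hg.concaveOn.slope_anti_adjacent (x := q₀ / 2) (y := q₀) (z := q)
        (Set.mem_Ici.2 (by linarith)) (Set.mem_Ici.2 (by linarith)) (by linarith) hlt
      have h4 : l ≤ (g q - g q₀) / (q - q₀) := by
        rw [le_div_iff₀ (sub_pos.2 hlt)]; linarith
      have h5 := h4.trans h3
      rw [le_div_iff₀ (by linarith)] at h5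
      linarith
  linarith

end IsRateFunction

/-! ### Left limits of the harvested total -/

namespace Arrivals

/-- The total amount harvested strictly before time `t`. -/
noncomputable def totalBefore (A : Arrivals) (t : ℝ) : ℝ :=
  ∑ i ∈ (A.finite_le t).toFinset with A.time i < t, A.amount i

theorem totalBefore_le_total (A : Arrivals) (t : ℝ) : A.totalBefore t ≤ A.total t := by
  refine Finset.sum_le_sum_of_subset_of_nonneg (Finset.filter_subset _ _) fun i hi _ => ?_
  exact (A.amount_pos i ((A.finite_le t).mem_toFinset.1 hi).1).le

theorem total_le_totalBefore (A : Arrivals) {s t : ℝ} (h : s < t) :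
    A.total s ≤ A.totalBefore t := by
  refine Finset.sum_le_sum_of_subset_of_nonneg (fun i hi => ?_) fun i hi _ => ?_
  · have hi := (A.finite_le s).mem_toFinset.1 hi
    simp only [Finset.mem_filter, Set.Finite.mem_toFinset, Set.mem_ofPred_eq]
    exact ⟨⟨hi.1, hi.2.trans h.le⟩, hi.2.trans_lt h⟩
  · exact (A.amount_pos i ((A.finite_le t).mem_toFinset.1 (Finset.mem_filter.1 hi).1).1).le

theorem totalBefore_lt_total (A : Arrivals) {i : ℕ} (hi : (i : ℕ∞) < A.count) :
    A.totalBefore (A.time i) < A.total (A.time i) := by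
  refine Finset.sum_lt_sum_of_subset (i := i) (Finset.filter_subset _ _) ?_ ?_
    (A.amount_pos i hi) fun j hj _ => ?_
  · simp [hi]
  · simp
  · exact (A.amount_pos j ((A.finite_le _).mem_toFinset.1 hj).1).le

/-- If there is no arrival in `[s, t)`, then nothing is harvested there. -/
theorem totalBefore_eq (A : Arrivals) {s t : ℝ} (hst : s ≤ t)
    (h : ∀ i : ℕ, (i : ℕ∞) < A.count → s ≤ A.time i → t ≤ A.time i) :
    A.totalBefore t = A.totalBefore s := by
  unfold totalBefore
  congr 1
  ext i
  simp only [Finset.mem_filter, Set.Finite.mem_toFinset, Set.mem_ofPred_eq]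
  constructor
  · rintro ⟨⟨h1, -⟩, h2⟩
    have : A.time i < s := by
      by_contra hc
      exact absurd (h i h1 (not_lt.1 hc)) (not_le.2 h2)
    exact ⟨⟨h1, this.le⟩, this⟩
  · rintro ⟨⟨h1, -⟩, h2⟩
    exact ⟨⟨h1, (h2.trans_le hst).le⟩, h2.trans_le hst⟩

theorem total_zero_pos (A : Arrivals) : 0 < A.total 0 := by
  have := A.totalBefore_lt_total (i := 0) (by simpa using A.count_pos)
  rw [A.time_zero] at this
  exact (Finset.sum_nonneg fun i hi =>
    (A.amount_pos i ((A.finite_le _).mem_toFinset.1 (Finset.mem_filter.1 hi).1).1).le).trans_lt this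

theorem total_nonneg (A : Arrivals) (t : ℝ) : 0 ≤ A.total t :=
  Finset.sum_nonneg fun i hi => (A.amount_pos i ((A.finite_le t).mem_toFinset.1 hi).1).le

/-- A continuous function that stays below the harvested total stays below its left limits. -/
theorem le_totalBefore (A : Arrivals) {f : ℝ → ℝ} (hf : Continuous f) {s t : ℝ} (hst : s < t)
    (h : ∀ u ∈ Set.Ico s t, f u ≤ A.total u) : f t ≤ A.totalBefore t := by
  have hlim : Filter.Tendsto f (nhdsWithin t (Set.Iio t)) (nhds (f t)) :=
    hf.continuousAt.tendsto.mono_left nhdsWithin_le_nhds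
  refine le_of_tendsto hlim ?_
  filter_upwards [Ico_mem_nhdsLT hst] with u hu
  exact (h u hu).trans (A.total_le_totalBefore hu.2)

end Arrivals

/-! ### The taut-string policy -/

/-- `β` and `ε` satisfy on `[s, T]` the bounds of the bits and the energy of a policy that come from
the affine majorants, of slope `L q`, touching `g` at the powers `q ≥ q₀`. -/
def IsTransmissionCurve (g L : ℝ → ℝ) (q₀ s T : ℝ) (β ε : ℝ → ℝ) : Prop :=
  ∀ q, q₀ ≤ q → ∀ x y, s ≤ x → x ≤ y → y ≤ T →
    β y - β x ≤ (g q - L q * q) * (y - x) + L q * (ε y - ε x)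

/-- The steepest line from `(s, a)` that stays below the harvested total up to time `T` touches it
at some time `c`, which is `T` or an arrival time. -/
theorem exists_touching_slope (A : Arrivals) {s T a : ℝ} (hsT : s < T) (ha : a < A.total s) :
    ∃ c q, s < c ∧ c ≤ T ∧ 0 < q ∧ A.totalBefore c = a + q * (c - s) ∧
      (∀ t, s < t → t ≤ T → a + q * (t - s) ≤ A.totalBefore t) ∧
      (c < T → ∃ i : ℕ, (i : ℕ∞) < A.count ∧ A.time i = c) := by
  classical
  -- Between arrivals `totalBefore` is constant while `t - s` grows, so the slope is minimal at an
  -- arrival time or at `T`.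
  set D : Finset ℝ := {t ∈ insert T ((A.finite_le T).toFinset.image A.time) | s < t} with hD
  have hmem : ∀ t, t ∈ D ↔ (t = T ∨ ∃ i : ℕ, ((i : ℕ∞) < A.count ∧ A.time i ≤ T) ∧ A.time i = t)
      ∧ s < t := by
    intro t; simp [hD]
  have hT : T ∈ D := (hmem T).2 ⟨Or.inl rfl, hsT⟩
  have hle : ∀ t ∈ D, t ≤ T := by
    intro t ht
    rcases ((hmem t).1 ht).1 with rfl | ⟨i, hi, rfl⟩
    · exact le_rfl
    · exact hi.2
  obtain ⟨c, hc, hmin⟩ := D.exists_min_image (fun t => (A.totalBefore t - a) / (t - s)) ⟨T, hT⟩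
  have hsc : s < c := ((hmem c).1 hc).2
  have hq : 0 < (A.totalBefore c - a) / (c - s) :=
    div_pos (by linarith [A.total_le_totalBefore hsc]) (sub_pos.2 hsc)
  refine ⟨c, _, hsc, hle c hc, hq, ?_, fun t hst htT => ?_, fun hcT => ?_⟩
  · rw [div_mul_cancel₀ _ (sub_pos.2 hsc).ne']; ring
  -- `b` is the first candidate time from `t` on; nothing is harvested in `[t, b)`, so the bound at
  -- `b` carries over to `t`.
  · obtain ⟨b, hb, hbmin⟩ := Finset.exists_min_image {b ∈ D | t ≤ b} id
      ⟨T, Finset.mem_filter.2 ⟨hT, htT⟩⟩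
    obtain ⟨hbD, htb⟩ := Finset.mem_filter.1 hb
    have h1 := hmin b hbD
    rw [le_div_iff₀ (by linarith)] at h1
    have h2 : A.totalBefore b = A.totalBefore t := by
      refine A.totalBefore_eq htb fun i hi hti => ?_
      by_cases hiT : A.time i ≤ T
      · exact hbmin _ (Finset.mem_filter.2
          ⟨(hmem _).2 ⟨Or.inr ⟨i, ⟨hi, hiT⟩, rfl⟩, hst.trans_le hti⟩, hti⟩)
      · exact (hle b hbD).trans (not_le.1 hiT).le
    have h3 := mul_le_mul_of_nonneg_left (show t - s ≤ b - s by linarith) hq.le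
    linarith
  · rcases ((hmem c).1 hc).1 with h | ⟨i, hi, h⟩
    · exact absurd h hcT.ne
    · exact ⟨i, hi.1, h⟩

/-- Over `[s, T]`, with the energy `a` used before, there is a policy without breaks that sends at
least as many bits as every transmission curve. -/
theorem exists_maximal_policy (A : Arrivals) {g L : ℝ → ℝ}
    (hL : ∀ q, 0 < q → ∀ p, 0 ≤ p → g p ≤ g q + L q * (p - q)) (hL0 : ∀ q, 0 < q → 0 ≤ L q)
    (T : ℝ) (n : ℕ) :
    ∀ s a : ℝ, 0 ≤ s → s ≤ T → (s < T → a < A.total s) →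
      ((A.finite_le T).toFinset.filter (fun i => s < A.time i)).card < n →
      ∃ X : Policy, X.start = s ∧ X.finish = T ∧ X.NoBreaks ∧
        (∀ t, s < t → t ≤ T → a + X.energy t ≤ A.totalBefore t) ∧
        ∀ q₀, 0 < q₀ → (∀ t, s < t → t ≤ T → a + q₀ * (t - s) ≤ A.totalBefore t) →
          ∀ β ε : ℝ → ℝ, IsTransmissionCurve g L q₀ s T β ε →
            (∀ t, s < t → t ≤ T → ε t ≤ A.totalBefore t) → ε s ≤ a →
            β T - β s ≤ X.bits g T + L q₀ * (a - ε s) := by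
  classical
  have hempty : ∀ a : ℝ, ∀ hT : 0 ≤ T, ∃ X : Policy, X.start = T ∧ X.finish = T ∧ X.NoBreaks ∧
      (∀ t, T < t → t ≤ T → a + X.energy t ≤ A.totalBefore t) ∧
      ∀ q₀, 0 < q₀ → (∀ t, T < t → t ≤ T → a + q₀ * (t - T) ≤ A.totalBefore t) →
        ∀ β ε : ℝ → ℝ, IsTransmissionCurve g L q₀ T T β ε →
          (∀ t, T < t → t ≤ T → ε t ≤ A.totalBefore t) → ε T ≤ a →
          β T - β T ≤ X.bits g T + L q₀ * (a - ε T) := by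
    intro a hT
    refine ⟨Policy.empty T hT, rfl, rfl, Policy.empty_noBreaks T hT, fun t h1 h2 => by linarith, ?_⟩
    intro q₀ hq₀ _ β ε _ _ hε
    rw [Policy.empty_bits, sub_self, zero_add]
    exact mul_nonneg (hL0 _ hq₀) (by linarith)
  -- The induction is on a strict bound for the number of arrivals in `(s, T]`, which makes the base
  -- case vacuous.
  induction n with
  | zero => intro s a _ _ _ h; simp at h
  | succ n ih =>
    intro s a hs hsT ha hcard
    rcases hsT.eq_or_lt with rfl | hlt
    · exact hempty a hs
    obtain ⟨c, q, hsc, hcT, hq, hc, hline, harr⟩ := exists_touching_slope A hlt (ha hlt)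
    -- At the touching time `c` all energy harvested before `c` is spent. The rest of the string
    -- starts from there, with the arrival at `c` no longer ahead.
    obtain ⟨X, hX1, hX2, hX3, hX4, hX5⟩ : ∃ X : Policy, X.start = c ∧ X.finish = T ∧ X.NoBreaks ∧
        (∀ t, c < t → t ≤ T → A.totalBefore c + X.energy t ≤ A.totalBefore t) ∧
        ∀ q₀, 0 < q₀ → (∀ t, c < t → t ≤ T →
            A.totalBefore c + q₀ * (t - c) ≤ A.totalBefore t) →
          ∀ β ε : ℝ → ℝ, IsTransmissionCurve g L q₀ c T β ε →
            (∀ t, c < t → t ≤ T → ε t ≤ A.totalBefore t) → ε c ≤ A.totalBefore c →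
            β T - β c ≤ X.bits g T + L q₀ * (A.totalBefore c - ε c) := by
      rcases hcT.eq_or_lt with rfl | hcT'
      · exact hempty _ (hs.trans hsT)
      obtain ⟨i, hi, hic⟩ := harr hcT'
      refine ih c _ (hs.trans hsc.le) hcT (fun _ => hic ▸ A.totalBefore_lt_total hi)
        (lt_of_lt_of_le (Finset.card_lt_card ?_) (Nat.lt_succ_iff.1 hcard))
      refine (Finset.ssubset_iff_of_subset fun j hj => ?_).2 ⟨i, ?_, ?_⟩
      · rw [Finset.mem_filter] at hj ⊢
        exact ⟨hj.1, hsc.trans hj.2⟩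
      · simp [hi, hic, hcT, hsc]
      · simp [hic]
    have hsX : s ≤ X.start := hX1 ▸ hsc.le
    refine ⟨Policy.cons q s X hq.le hs hsX, rfl, hX2, hX3.cons q s hq.le hs hsX hq.ne', ?_, ?_⟩
    · intro t hst htT
      rw [Policy.cons_energy, hX1, min_eq_right hst.le]
      rcases le_or_gt t c with h | h
      · rw [min_eq_left h, X.energy_of_le_start (by rwa [hX1])]
        linarith [hline t hst htT]
      · rw [min_eq_right h.le]
        linarith [hX4 t h htT]
    · intro q₀ hq₀ hq₀line β ε hcurve hε hεs
      -- `q₀` bounds all powers of the string from below: its line stays under the total, which the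
      -- line of slope `q` meets at `c`.
      have hqq : q₀ ≤ q := by
        have := hq₀line c hsc hcT
        rw [hc] at this
        exact le_of_mul_le_mul_right (by linarith) (sub_pos.2 hsc)
      have hLL : L q ≤ L q₀ := by
        rcases hqq.eq_or_lt with rfl | h
        · exact le_rfl
        · refine le_of_mul_le_mul_right ?_ (sub_pos.2 h)
          linarith [hL q₀ hq₀ q hq.le, hL q hq q₀ hq₀.le]
      -- From `c` on, `q` takes the role of `q₀`: powers never decrease along the string. Energy
      -- that the competitor has saved is valued at the slope `L`, which falls as the power rises,
      -- so the terms in `ε c` cancel and `L q ≤ L q₀` absorbs the rest.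
      have h1 := hX5 q hq (fun t h1 h2 => by linarith [hline t (hsc.trans h1) h2]) β ε
        (fun r hr x y hx hxy hy => hcurve r (hqq.trans hr) x y (hsc.le.trans hx) hxy hy)
        (fun t h1 h2 => hε t (hsc.trans h1) h2) (hε c hsc hcT)
      have h2 := hcurve q hqq s c le_rfl hsc.le hcT
      have h3 := mul_le_mul_of_nonneg_right hLL (sub_nonneg.2 hεs)
      rw [Policy.cons_bits, hX1, min_eq_right hcT, min_eq_right hlt.le]
      rw [hc] at h1
      linarith

/-! ### Removing breaks -/

theorem Policy.bits_eq_of_onTime_eq (P : Policy) {g : ℝ → ℝ} (hg0 : g 0 = 0) {t u : ℝ}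
    (h : t ≤ u) (hC : P.onTime t = P.onTime u) : P.bits g t = P.bits g u := by
  classical
  have h0 : ∑ i, (if P.p i ≠ 0 then P.elapsed i u - P.elapsed i t else 0) = 0 := by
    have : P.onTime u - P.onTime t = 0 := by rw [hC, sub_self]
    unfold Policy.onTime at this
    rw [← Finset.sum_sub_distrib] at this
    refine Eq.trans (Finset.sum_congr rfl fun i _ => ?_) this
    split_ifs <;> simp
  rw [Finset.sum_eq_zero_iff_of_nonneg fun i _ => by
    have := P.elapsed_mono i h
    split_ifs <;> simp [this]] at h0
  refine Finset.sum_congr rfl fun i hi => ?_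
  have := h0 i hi
  by_cases hp : P.p i = 0
  · simp [hp, hg0]
  · simp only [ne_eq, hp, not_false_eq_true, if_true] at this
    rw [sub_eq_zero.1 this]

/-- Over `[s, T]` some policy without breaks sends the greatest number of bits: it sends at least as
many as any policy whose on-time until `T` fits into `[s, T]`, and more if there is room left. -/
theorem exists_dominating_policy (tx : Arrivals) {g : ℝ → ℝ} (hg : IsRateFunction g) {s T : ℝ}
    (hs : 0 ≤ s) (hsT : s ≤ T) :
    ∃ X : Policy, X.start = s ∧ X.finish = T ∧ X.NoBreaks ∧
      (∀ t ≤ T, X.energy t ≤ tx.total t) ∧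
      ∃ κ, 0 < κ ∧ ∀ Q : Policy, (∀ t ∈ Set.Icc 0 T, Q.energy t ≤ tx.total t) →
        s ≤ T - Q.onTime T → Q.bits g T + κ * (T - Q.onTime T - s) ≤ X.bits g T := by
  choose! L hL0 hL using fun q (hq : 0 < q) => hg.exists_supergradient hq
  have hE0 : 0 < tx.total 0 := tx.total_zero_pos
  obtain ⟨X, h1, h2, h3, h4, h5⟩ := exists_maximal_policy tx hL hL0 T _ s 0 hs hsT
    (fun _ => hE0.trans_le (tx.total_mono hs)) (Nat.lt_succ_self _)
  refine ⟨X, h1, h2, h3, fun t ht => ?_, ?_⟩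
  · rcases le_or_gt t s with h | h
    · rw [X.energy_of_le_start (h1 ▸ h)]
      exact tx.total_nonneg t
    · linarith [h4 t h ht, tx.totalBefore_le_total t]
  have hd : 0 < T - s + 1 := by linarith
  -- A line of this slope from `(s, 0)` stays below the initial energy until `T`; the `+ 1` keeps
  -- the divisor positive when `s = T`.
  have hq₀ : 0 < tx.total 0 / (T - s + 1) := div_pos hE0 hd
  obtain ⟨κ, hκ, hκle⟩ := hg.exists_pos_le_intercept hq₀
  refine ⟨κ, hκ, fun Q hQ hsQ => ?_⟩
  have hC0 : 0 ≤ Q.onTime T := by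
    rw [← Q.onTime_zero]; exact Q.onTime_mono (hs.trans hsT)
  set m := T - Q.onTime T with hm
  have hmT : m ≤ T := by linarith
  -- The on-time of `Q` is packed into `[m, T]`: `ψ y` is a time at which `Q` has been on for `y -
  -- m`. As `ψ y ≤ y`, energy is only used later than in `Q`. Before `m` the value `0` stands for
  -- nothing having been sent.
  have hψ : ∀ y, ∃ u, (y ≤ m → u = 0) ∧
      (m < y → y ≤ T → 0 ≤ u ∧ u ≤ T ∧ u ≤ y ∧ Q.onTime u = y - m) := by
    intro y
    rcases le_or_gt y m with h | h
    · exact ⟨0, fun _ => rfl, fun h' => absurd h (not_le.2 h')⟩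
    · by_cases hy : y ≤ T
      · obtain ⟨u, hu, hCu⟩ := intermediate_value_Icc (hs.trans hsT)
          Q.continuous_onTime.continuousOn (show y - m ∈ Set.Icc (Q.onTime 0) (Q.onTime T) by
            rw [Q.onTime_zero]; constructor <;> linarith)
        refine ⟨u, fun h' => absurd h' (not_le.2 h), fun _ _ => ⟨hu.1, hu.2, ?_, hCu⟩⟩
        linarith [Q.onTime_sub_le hu.2]
      · exact ⟨0, fun _ => rfl, fun _ h' => absurd h' hy⟩
  choose ψ hψ0 hψ1 using hψ
  -- The competitor is the packed `Q` with a fictitious bonus of `κ` bits per unit of time on `[s,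
  -- m]`, at no energy. It obeys the bounds because every relevant intercept is at least `κ`;
  -- beating it yields the strict gain from idle time.
  have hkey := h5 _ hq₀ ?_ (fun y => Q.bits g (ψ y) + κ * (min y m - s))
    (fun y => Q.energy (ψ y)) ?_ ?_ ?_
  · simp only [hψ0 s hsQ, Q.bits_zero, Q.energy_zero, min_eq_left hsQ, min_eq_right hmT,
      sub_self, mul_zero, add_zero, sub_zero] at hkey
    have hbits : Q.bits g (ψ T) = Q.bits g T := by
      rcases hmT.eq_or_lt with h | h
      · rw [hψ0 T h.ge]
        refine Q.bits_eq_of_onTime_eq hg.map_zero (hs.trans hsT) ?_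
        rw [Q.onTime_zero]; linarith
      · obtain ⟨-, h6, -, h7⟩ := hψ1 T h le_rfl
        exact Q.bits_eq_of_onTime_eq hg.map_zero h6 (by rw [h7]; linarith)
    rwa [hbits] at hkey
  · intro t hst htT
    rw [zero_add]
    refine le_trans ?_ (tx.total_le_totalBefore (hs.trans_lt hst))
    calc tx.total 0 / (T - s + 1) * (t - s) ≤ tx.total 0 / (T - s + 1) * (T - s + 1) :=
          mul_le_mul_of_nonneg_left (by linarith) hq₀.le
      _ = tx.total 0 := div_mul_cancel₀ _ hd.ne'
  · intro q hq x y hsx hxy hyT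
    have hκq := hκle q (L q) hq (hL q (hq₀.trans_le hq))
    have hbd := fun {u v : ℝ} (h : u ≤ v) =>
      Q.bits_sub_le hg.map_zero (hL q (hq₀.trans_le hq)) h
    dsimp only
    rcases le_or_gt y m with hy | hy
    · rw [hψ0 y hy, hψ0 x (hxy.trans hy), min_eq_left hy, min_eq_left (hxy.trans hy)]
      have := mul_le_mul_of_nonneg_right hκq (sub_nonneg.2 hxy)
      linarith
    obtain ⟨y0, -, -, hyC⟩ := hψ1 y hy hyT
    rcases le_or_gt x m with hx | hx
    · rw [hψ0 x hx, min_eq_left hx, min_eq_right hy.le]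
      have h6 := hbd y0
      rw [Q.onTime_zero, hyC] at h6
      have := mul_le_mul_of_nonneg_right hκq (sub_nonneg.2 hx)
      linarith
    · obtain ⟨-, -, -, hxC⟩ := hψ1 x hx (hxy.trans hyT)
      rw [min_eq_right hx.le, min_eq_right hy.le]
      rcases hxy.eq_or_lt with rfl | hlt
      · simp
      have h6 := hbd (u := ψ x) (v := ψ y) (by
        by_contra hc
        have := Q.onTime_mono (not_le.1 hc).le
        linarith)
      rw [hyC, hxC] at h6
      linarith
  · intro t hst htT
    have ht0 : 0 < t := hs.trans_lt hst
    rcases le_or_gt t m with h | h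
    · rw [hψ0 t h, Q.energy_zero]
      exact hE0.le.trans (tx.total_le_totalBefore ht0)
    · exact (Q.energy_mono (hψ1 t h htT).2.2.1).trans
        (tx.le_totalBefore Q.continuous_energy ht0 fun u hu =>
          hQ u ⟨hu.1, hu.2.le.trans htT⟩)
  · rw [hψ0 s hsQ, Q.energy_zero]

/-- A policy whose on-time until `T` fits into `[s, T]` can be replaced by one without breaks that
starts at `s`, and which finishes before `T` if there is room left. -/
theorem exists_noBreaks_of_policy (tx : Arrivals) {g : ℝ → ℝ} (hg : IsRateFunction g) {s T B₀ : ℝ}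
    (hB₀ : 0 < B₀) (hs : 0 ≤ s) (Q : Policy) (hT : 0 ≤ T)
    (hQ : ∀ t ∈ Set.Icc 0 T, Q.energy t ≤ tx.total t)
    (hsQ : s ≤ T - Q.onTime T) (hbits : B₀ ≤ Q.bits g T) :
    ∃ Y : Policy, Y.start = s ∧ Y.finish ≤ T ∧ Y.NoBreaks ∧ Y.bits g Y.finish = B₀ ∧
      (∀ t ≤ Y.finish, Y.energy t ≤ tx.total t) ∧ (s < T - Q.onTime T → Y.finish < T) := by
  have hC0 : 0 ≤ Q.onTime T := by rw [← Q.onTime_zero]; exact Q.onTime_mono hT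
  have hsT : s ≤ T := by linarith
  obtain ⟨X, h1, h2, h3, h4, κ, hκ, h5⟩ := exists_dominating_policy tx hg hs hsT
  have h6 := h5 Q hQ hsQ
  have h7 : 0 ≤ κ * (T - Q.onTime T - s) := mul_nonneg hκ.le (by linarith)
  obtain ⟨T', hT1, hT2, hT3⟩ := X.exists_cut g hB₀.le (by rw [h2]; linarith)
  rw [h1] at hT1
  rw [h2] at hT2
  have hfin : (X.cut T' (hs.trans hT1)).finish = T' := by
    rw [X.cut_finish, h2, min_eq_right hT2]
  refine ⟨X.cut T' (hs.trans hT1), ?_, hfin.trans_le hT2, h3.cut _ _, ?_, fun t ht => ?_,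
    fun hlt => ?_⟩
  · rw [X.cut_start, h1, min_eq_left hT1]
  · rw [hfin, X.cut_bits, min_self, hT3]
  · rw [hfin] at ht
    rw [X.cut_energy, min_eq_left ht]
    exact h4 t (ht.trans hT2)
  · rw [hfin]
    -- Were the cut at `T` itself, `X` would send exactly `B₀` bits by `T`, contradicting the gain
    -- over `Q`.
    refine hT2.lt_of_ne ?_
    rintro rfl
    have : 0 < κ * (T' - Q.onTime T' - s) := mul_pos hκ (by linarith)
    linarith

theorem origin_nonneg (rx : Arrivals) (i : ℕ) : 0 ≤ origin rx i :=
  Real.sInf_nonneg fun _ h => h.1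

/-! ### Solutions of `OFF(O_i)` -/

section Single

variable {tx rx : Arrivals} {g : ℝ → ℝ} {B₀ : ℝ} {i : ℕ}

theorem singleFeasible_of_noBreaks {X : Policy} (hX : X.NoBreaks) (hbits : X.bits g X.finish = B₀)
    (henergy : ∀ t ≤ X.finish, X.energy t ≤ tx.total t) (hO : origin rx i ≤ X.start)
    (hlen : X.finish - X.start ≤ budget rx i) : SingleFeasible tx rx g B₀ i X := by
  refine ⟨hbits, fun t ht => henergy t ht.2, fun t ht => ?_, fun t ht => ?_⟩
  · exact (X.onTime_mono ht.2).trans (hX.onTime_finish.trans_le hlen)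
  · exact ⟨X.onTime_of_le_start (ht.2.trans hO), X.energy_of_le_start (ht.2.trans hO)⟩

theorem SingleFeasible.origin_le_finish (hg : IsRateFunction g) (hB₀ : 0 < B₀) {Q : Policy}
    (hQ : SingleFeasible tx rx g B₀ i Q) : origin rx i ≤ Q.finish := by
  by_contra hc
  have h := hQ.2.2.2 Q.finish ⟨Q.finish_nonneg, (not_le.1 hc).le⟩
  have := Q.bits_eq_of_onTime_eq hg.map_zero Q.finish_nonneg (by rw [Q.onTime_zero, h.1])
  rw [Q.bits_zero, hQ.1] at this
  exact hB₀.ne this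

theorem SingleFeasible.energy_le {Q : Policy} (hQ : SingleFeasible tx rx g B₀ i Q) {t : ℝ}
    (ht : t ∈ Set.Icc 0 Q.finish) : Q.energy t ≤ tx.total t := by
  rcases le_total t (origin rx i) with h | h
  · rw [(hQ.2.2.2 t ⟨ht.1, h⟩).2]
    exact tx.total_nonneg t
  · exact hQ.2.1 t ⟨h, ht.2⟩

theorem SingleFeasible.onTime_le {Q : Policy} (hQ : SingleFeasible tx rx g B₀ i Q) {t : ℝ}
    (ht : origin rx i ≤ t) : Q.onTime t ≤ t - origin rx i := by
  have := Q.onTime_sub_le ht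
  rwa [(hQ.2.2.2 _ ⟨origin_nonneg rx i, le_rfl⟩).1, sub_zero] at this

theorem SingleFeasible.origin_le_start (hg : IsRateFunction g) (hB₀ : 0 < B₀) {X : Policy}
    (hX : SingleFeasible tx rx g B₀ i X) (hN : X.NoBreaks) : origin rx i ≤ X.start := by
  have h1 := hX.origin_le_finish hg hB₀
  have h2 := (hX.2.2.2 _ ⟨origin_nonneg rx i, le_rfl⟩).1
  rw [hN.onTime_eq, min_eq_left h1] at h2
  exact min_eq_left_iff.1 (sub_eq_zero.1 h2).symm

theorem SingleFeasible.length_le (hg : IsRateFunction g) (hB₀ : 0 < B₀) {X : Policy}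
    (hX : SingleFeasible tx rx g B₀ i X) (hN : X.NoBreaks) :
    X.finish - X.start ≤ budget rx i := by
  rw [← hN.onTime_finish]
  exact hX.2.2.1 _ ⟨hX.origin_le_finish hg hB₀, le_rfl⟩

/-- In a short time only few bits can be sent, whatever the power. -/
theorem exists_bits_sub_lt (hg : IsRateFunction g) {η : ℝ} (E : ℝ) (hη : 0 < η) :
    ∃ δ, 0 < δ ∧ ∀ (Q : Policy) (t u : ℝ), 0 ≤ t → t ≤ u → u < t + δ → Q.energy u ≤ E →
      Q.bits g u - Q.bits g t < η := by
  -- For large `q` the slope is at most `g q / q`, so the energy term is below `η / 2`; the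
  -- intercept term is then made small by a short duration.
  obtain ⟨q, hq0, hqE⟩ : ∃ q, 0 < q ∧ g q / q * E < η / 2 := by
    have h : Filter.Tendsto (fun p => g p / p * E) Filter.atTop (nhds 0) := by
      simpa using hg.tendsto_div.mul_const E
    exact ((Filter.eventually_gt_atTop 0).and
      (h.eventually (gt_mem_nhds (half_pos hη)))).exists
  obtain ⟨l, hl0, hl⟩ := hg.exists_supergradient hq0
  have hint : 0 ≤ g q - l * q := by
    have := hl 0 le_rfl
    rw [hg.map_zero] at this; linarith
  have hlq : l ≤ g q / q := by rw [le_div_iff₀ hq0]; linarith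
  have hgq := hg.nonneg hq0.le
  refine ⟨η / 2 / (g q + 1), div_pos (half_pos hη) (by linarith), fun Q t u ht htu hu hQE => ?_⟩
  have h1 := Q.bits_sub_le hg.map_zero hl htu
  have h2 : (g q - l * q) * (Q.onTime u - Q.onTime t) ≤ (g q + 1) * (u - t) :=
    mul_le_mul (by nlinarith) (Q.onTime_sub_le htu) (sub_nonneg.2 (Q.onTime_mono htu))
      (by linarith)
  have h3 : (g q + 1) * (u - t) < η / 2 := by
    have : u - t < η / 2 / (g q + 1) := by linarith
    rw [lt_div_iff₀ (by linarith)] at this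
    linarith
  have h4 : 0 ≤ Q.energy t := by rw [← Q.energy_zero]; exact Q.energy_mono ht
  have h5 : l * (Q.energy u - Q.energy t) ≤ g q / q * E :=
    mul_le_mul hlq (by linarith) (sub_nonneg.2 (Q.energy_mono htu)) (div_nonneg hgq hq0.le)
  linarith

/-- If `OFF(O_i)` is feasible, then it has a solution without breaks. -/
theorem exists_solvesOFF (hg : IsRateFunction g) (hB₀ : 0 < B₀)
    (h : ∃ Q, SingleFeasible tx rx g B₀ i Q) : ∃ X, SolvesOFF tx rx g B₀ i X := by
  set S : Set ℝ := {T | ∃ Q, SingleFeasible tx rx g B₀ i Q ∧ Q.finish = T} with hS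
  have hne : S.Nonempty := h.elim fun Q hQ => ⟨_, Q, hQ, rfl⟩
  have hlb : ∀ T ∈ S, origin rx i ≤ T := by
    rintro _ ⟨Q, hQ, rfl⟩
    exact hQ.origin_le_finish hg hB₀
  have hbdd : BddBelow S := ⟨_, hlb⟩
  set T := sInf S with hT
  have hOT : origin rx i ≤ T := le_csInf hne hlb
  have hT0 : 0 ≤ T := (origin_nonneg rx i).trans hOT
  -- The earliest start that `O_i` and the budget allow for a policy without breaks that finishes at
  -- `T`.
  set s := max (origin rx i) (T - budget rx i) with hs
  have hs0 : 0 ≤ s := (origin_nonneg rx i).trans (le_max_left _ _)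
  have hΓ : 0 ≤ budget rx i := rx.total_nonneg _
  have hsT : s ≤ T := max_le hOT (by linarith)
  obtain ⟨X, h1, h2, h3, h4, κ, hκ, h5⟩ := exists_dominating_policy tx hg hs0 hsT
  -- A feasible policy finishing just after the infimum `T` has sent almost `B₀` bits by `T`, and
  -- `X` sends at least as many.
  have hXbits : B₀ ≤ X.bits g T := by
    refine le_of_forall_pos_le_add fun η hη => ?_
    obtain ⟨δ, hδ, hsmall⟩ := exists_bits_sub_lt hg (tx.total (T + 1)) hη
    obtain ⟨_, ⟨Q, hQ, rfl⟩, hlt⟩ := exists_lt_of_csInf_lt hne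
      (show T < T + min δ 1 by linarith [lt_min hδ one_pos])
    have hTQ : T ≤ Q.finish := csInf_le hbdd ⟨Q, hQ, rfl⟩
    have h6 := hsmall Q T Q.finish hT0 hTQ (by linarith [min_le_left δ 1])
      ((hQ.energy_le ⟨Q.finish_nonneg, le_rfl⟩).trans
        (tx.total_mono (by linarith [min_le_right δ 1])))
    have h7 : s ≤ T - Q.onTime T := by
      refine max_le ?_ ?_
      · linarith [hQ.onTime_le hOT]
      · linarith [hQ.2.2.1 T ⟨hOT, hTQ⟩]
    have h8 := h5 Q (fun t ht => hQ.energy_le ⟨ht.1, ht.2.trans hTQ⟩) h7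
    have h9 : 0 ≤ κ * (T - Q.onTime T - s) := mul_nonneg hκ.le (by linarith)
    rw [hQ.1] at h6
    linarith
  obtain ⟨Y, hY1, hY2, hY3, hY4, hY5, -⟩ := exists_noBreaks_of_policy tx hg hB₀ hs0 X hT0
    (fun t ht => h4 t ht.2) (by
      have := h3.onTime_finish
      rw [h2, h1] at this
      linarith) hXbits
  refine ⟨Y, ⟨singleFeasible_of_noBreaks hY3 hY4 hY5 (hY1 ▸ le_max_left _ _) ?_, ?_⟩, hY3⟩
  · have := le_max_right (origin rx i) (T - budget rx i)
    rw [hY1]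
    linarith
  · exact fun Q hQ => hY2.trans (csInf_le hbdd ⟨Q, hQ, rfl⟩)

/-- A solution without breaks of `OFF(O_i)` that starts after `O_i` uses the whole on-time. -/
theorem SolvesOFF.length_eq (hg : IsRateFunction g) (hB₀ : 0 < B₀) {X : Policy}
    (hX : SolvesOFF tx rx g B₀ i X) (hO : origin rx i < X.start) :
    X.finish - X.start = budget rx i := by
  obtain ⟨⟨hF, hmin⟩, hN⟩ := hX
  refine le_antisymm (hF.length_le hg hB₀ hN) ?_
  by_contra! hc
  -- If on-time were left, starting earlier would be possible, and the room gained would give a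
  -- strictly earlier finish.
  set s := max (origin rx i) (X.finish - budget rx i) with hs
  have hlt : s < X.finish - X.onTime X.finish := by
    rw [hN.onTime_finish]
    exact max_lt (by linarith) (by linarith)
  obtain ⟨Y, hY1, hY2, hY3, hY4, hY5, hY6⟩ := exists_noBreaks_of_policy tx hg hB₀
    ((origin_nonneg rx i).trans (le_max_left _ _)) X X.finish_nonneg (fun t ht => hF.energy_le ht)
    hlt.le hF.1.ge
  refine (hY6 hlt).not_ge (hmin Y (singleFeasible_of_noBreaks hY3 hY4 hY5
    (hY1 ▸ le_max_left _ _) ?_))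
  have := le_max_right (origin rx i) (X.finish - budget rx i)
  rw [hY1]
  linarith

end Single

/-! ### Receiver budgets and the times `O_i` -/

section Origin

variable (rx : Arrivals)

theorem time_le_time {i j : ℕ} (hj : (j : ℕ∞) < rx.count) (hij : i ≤ j) :
    rx.time i ≤ rx.time j := by
  rcases hij.eq_or_lt with rfl | h
  · exact le_rfl
  · exact (rx.time_lt i j h hj).le

theorem budget_mono {i j : ℕ} (hj : (j : ℕ∞) < rx.count) (hij : i ≤ j) :
    budget rx i ≤ budget rx j :=
  rx.total_mono (time_le_time rx hj hij)

theorem budget_pos {i : ℕ} (hi : (i : ℕ∞) < rx.count) : 0 < budget rx i :=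
  rx.total_zero_pos.trans_le (rx.total_mono (rx.time_nonneg i hi))

/-- A larger budget extends the interval on which the receiver must be sustained, so fewer starting
times qualify. -/
theorem origin_mono {i j : ℕ} (hj : (j : ℕ∞) < rx.count) (hij : i ≤ j) :
    origin rx i ≤ origin rx j := by
  obtain ⟨h0, h1⟩ := (isLeast_origin rx j hj).1
  refine (isLeast_origin rx i ((Nat.cast_le.2 hij).trans_lt hj)).2 ⟨h0, fun t ht => h1 t ?_⟩
  exact ⟨ht.1, ht.2.trans (by linarith [budget_mono rx hj hij])⟩

/-- What is harvested before the arrival `i + 1` is harvested up to the arrival `i`. -/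
theorem total_le_budget {i : ℕ} (hi : (i : ℕ∞) < rx.count) {t : ℝ}
    (h : ((i + 1 : ℕ) : ℕ∞) < rx.count → t < rx.time (i + 1)) : rx.total t ≤ budget rx i := by
  refine Finset.sum_le_sum_of_subset_of_nonneg (fun j hj => ?_) fun j hj _ =>
    (rx.amount_pos j ((rx.finite_le _).mem_toFinset.1 hj).1).le
  obtain ⟨hj1, hj2⟩ := (rx.finite_le _).mem_toFinset.1 hj
  have hji : j ≤ i := by
    by_contra! hc
    have hi1 : ((i + 1 : ℕ) : ℕ∞) < rx.count :=
      (Nat.cast_le.2 (Nat.succ_le_of_lt hc)).trans_lt hj1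
    have := time_le_time rx hj1 (Nat.succ_le_of_lt hc)
    exact absurd (h hi1) (not_lt.2 (this.trans hj2))
  exact (rx.finite_le _).mem_toFinset.2 ⟨hj1, time_le_time rx hi hji⟩

/-- The first arrival up to which the on-time `C` has been harvested. -/
theorem exists_first_index {C T : ℝ} (hT : 0 ≤ T) (hC : C ≤ rx.total T) :
    ∃ k : ℕ, (k : ℕ∞) < rx.count ∧ C ≤ budget rx k ∧ (∀ j < k, budget rx j < C) ∧
      budget rx k ≤ rx.total T := by
  classical
  have hex : ∃ k : ℕ, (k : ℕ∞) < rx.count ∧ C ≤ budget rx k := by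
    obtain ⟨m, hm, hmax⟩ := (rx.finite_le T).toFinset.exists_max_image id
      ⟨0, (rx.finite_le T).mem_toFinset.2 ⟨by simpa using rx.count_pos, by rwa [rx.time_zero]⟩⟩
    have hm := (rx.finite_le T).mem_toFinset.1 hm
    refine ⟨m, hm.1, hC.trans (total_le_budget rx hm.1 fun hm1 => ?_)⟩
    by_contra! hc
    have := hmax (m + 1) ((rx.finite_le T).mem_toFinset.2 ⟨hm1, hc⟩)
    simp at this
  have hlt : ∀ j < Nat.find hex, budget rx j < C := fun j hj => by
    by_contra! hc
    exact Nat.find_min hex hj ⟨(Nat.cast_lt.2 hj).trans (Nat.find_spec hex).1, hc⟩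
  refine ⟨Nat.find hex, (Nat.find_spec hex).1, (Nat.find_spec hex).2, hlt, rx.total_mono ?_⟩
  -- For `k = j + 1`, minimality gives `Γ(r_j) < C ≤ Γ(T)`, so arrival `k` has taken place by `T`.
  rcases h : Nat.find hex with _ | j
  · rwa [rx.time_zero]
  · have hj : j < Nat.find hex := by omega
    by_contra! hc
    have := total_le_budget rx ((Nat.cast_lt.2 hj).trans (Nat.find_spec hex).1) fun _ => hc
    linarith [hlt j hj]

/-- If the receiver can be kept on from `s` to `T`, then `O_k ≤ s`, where `k` is the first arrival
up to which the on-time `T - s` has been harvested. -/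
theorem origin_le {k : ℕ} (hk : (k : ℕ∞) < rx.count) {s T : ℝ} (hs : 0 ≤ s)
    (hon : ∀ t ∈ Set.Icc s T, t - s ≤ rx.total t) (hkT : budget rx k ≤ rx.total T) :
    origin rx k ≤ s := by
  refine (isLeast_origin rx k hk).2 ⟨hs, fun t ht => ?_⟩
  rcases le_or_gt t T with h | h
  · exact hon t ⟨ht.1, h⟩
  · linarith [ht.2, rx.total_mono h.le]

/-- Spending all of `Γ(r_i)` requires the positive amount of arrival `i` to be there. This ties
rounds to arrival times when the number of rounds is bounded. -/
theorem time_le_origin_add {i : ℕ} (hi : (i : ℕ∞) < rx.count) :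
    rx.time i ≤ origin rx i + budget rx i := by
  have h1 := (isLeast_origin rx i hi).1.2 _
    ⟨by linarith [budget_pos rx hi], le_refl (origin rx i + budget rx i)⟩
  by_contra! hc
  have h2 := (rx.total_le_totalBefore hc).trans_lt (rx.totalBefore_lt_total hi)
  have : budget rx i = rx.total (rx.time i) := rfl
  linarith

end Origin

/-! ### Reduction to `OFF(O_k)` and correctness of `OFFM` -/

/-- If a feasible policy finishes at `T` with on-time `C`, then the receiver can be kept on without
a break from `T - C` to `T`. -/
theorem GeneralFeasible.sub_le_total {tx rx : Arrivals} {g : ℝ → ℝ} {B₀ : ℝ} {Q : Policy}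
    (hQ : GeneralFeasible tx rx g B₀ Q) {t : ℝ}
    (ht : t ∈ Set.Icc (Q.finish - Q.onTime Q.finish) Q.finish) :
    t - (Q.finish - Q.onTime Q.finish) ≤ rx.total t := by
  obtain ⟨u, hu, hCu⟩ := intermediate_value_Icc Q.finish_nonneg Q.continuous_onTime.continuousOn
    (show t - (Q.finish - Q.onTime Q.finish) ∈ Set.Icc (Q.onTime 0) (Q.onTime Q.finish) by
      rw [Q.onTime_zero]; constructor <;> linarith [ht.1, ht.2])
  rw [← hCu]
  exact (hQ.2.2 u hu).trans (rx.total_mono (by linarith [Q.onTime_sub_le hu.2]))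

section OFFM

variable {tx rx : Arrivals} {g : ℝ → ℝ} {B₀ : ℝ}

/-- Every feasible policy of the general problem can be replaced by one without breaks which is
feasible in some `OFF(O_k)`, where `k` is the first arrival that provides enough on-time. -/
theorem GeneralFeasible.exists_singleFeasible (hg : IsRateFunction g) (hB₀ : 0 < B₀) {Q : Policy}
    (hQ : GeneralFeasible tx rx g B₀ Q) :
    ∃ (k : ℕ) (s : ℝ), (k : ℕ∞) < rx.count ∧
      (∃ t : ℝ, B₀ ≤ budget rx k * g (tx.total t / budget rx k)) ∧
      origin rx k ≤ s ∧ (∀ j < k, budget rx j < Q.finish - s) ∧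
      ∃ Y : Policy, SingleFeasible tx rx g B₀ k Y ∧ Y.finish ≤ Q.finish := by
  obtain ⟨k, hk, hCk, hmin, hkT⟩ :=
    exists_first_index rx Q.finish_nonneg (hQ.2.2 _ ⟨Q.finish_nonneg, le_rfl⟩)
  set s := Q.finish - Q.onTime Q.finish with hs
  have hs0 : 0 ≤ s := by
    have := Q.onTime_sub_le Q.finish_nonneg
    rw [Q.onTime_zero] at this
    linarith
  have hOk : origin rx k ≤ s := origin_le rx hk hs0 (fun t ht => hQ.sub_le_total ht) hkT
  refine ⟨k, s, hk, ⟨Q.finish, ?_⟩, hOk, fun j hj => by linarith [hmin j hj], ?_⟩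
  · have hΓ := budget_pos rx hk
    have hE : 0 < tx.total Q.finish :=
      tx.total_zero_pos.trans_le (tx.total_mono Q.finish_nonneg)
    set q := tx.total Q.finish / budget rx k with hq
    -- Jensen's inequality via the majorant at the power that spreads all energy harvested by the
    -- finish over the budget: `k` passes the test defining `i₀`.
    obtain ⟨l, hl0, hl⟩ := hg.exists_supergradient (div_pos hE hΓ)
    have h1 := Q.bits_sub_le hg.map_zero hl Q.finish_nonneg
    rw [Q.bits_zero, Q.onTime_zero, Q.energy_zero, hQ.1, sub_zero, sub_zero, sub_zero] at h1
    have hint : 0 ≤ g q - l * q := by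
      have := hl 0 le_rfl
      rw [hg.map_zero] at this; linarith
    have h2 := mul_le_mul_of_nonneg_left hCk hint
    have h3 := mul_le_mul_of_nonneg_left (hQ.2.1 _ ⟨Q.finish_nonneg, le_rfl⟩) hl0
    have h4 : q * budget rx k = tx.total Q.finish := div_mul_cancel₀ _ hΓ.ne'
    calc B₀ ≤ (g q - l * q) * budget rx k + l * tx.total Q.finish := h1.trans (add_le_add h2 h3)
      _ = budget rx k * g q := by rw [← h4]; ring
  · obtain ⟨Y, hY1, hY2, hY3, hY4, hY5, -⟩ := exists_noBreaks_of_policy tx hg hB₀ hs0 Q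
      Q.finish_nonneg hQ.2.1 le_rfl hQ.1.ge
    refine ⟨Y, singleFeasible_of_noBreaks hY3 hY4 hY5 (hY1 ▸ hOk) ?_, hY2⟩
    rw [hY1]
    linarith

/-- From `s = max O_i t` on, the energy `tx.total s` is already present and can be spread evenly
over the whole budget; the result is then trimmed to `B₀` bits. -/
theorem exists_singleFeasible_of_le (hg : IsRateFunction g) (hB₀ : 0 < B₀) {i : ℕ}
    (hi : (i : ℕ∞) < rx.count) {t : ℝ} (ht : B₀ ≤ budget rx i * g (tx.total t / budget rx i)) :
    ∃ Q, SingleFeasible tx rx g B₀ i Q := by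
  have hΓ := budget_pos rx hi
  set s := max (origin rx i) t with hs
  have hs0 : 0 ≤ s := (origin_nonneg rx i).trans (le_max_left _ _)
  have hE : 0 < tx.total s := tx.total_zero_pos.trans_le (tx.total_mono hs0)
  set q := tx.total s / budget rx i with hq
  have hq0 : 0 < q := div_pos hE hΓ
  have hsT : s ≤ s + budget rx i := by linarith
  have hst : (Policy.empty (s + budget rx i) (hs0.trans hsT)).start = s + budget rx i := rfl
  set X := Policy.cons q s (Policy.empty (s + budget rx i) (hs0.trans hsT)) hq0.le hs0
    (hsT.trans_eq hst.symm) with hX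
  have hXN : X.NoBreaks := (Policy.empty_noBreaks _ (hs0.trans hsT)).cons q s hq0.le hs0
    (hsT.trans_eq hst.symm) hq0.ne'
  have hXs : X.start = s := rfl
  have hXf : X.finish = s + budget rx i := rfl
  have hXb : X.bits g X.finish = budget rx i * g q := by
    rw [hXf, hX, Policy.cons_bits, Policy.empty_bits, hst, min_self, min_eq_right hsT]
    ring
  have hXE : ∀ u, X.energy u ≤ tx.total u := fun u => by
    rcases le_or_gt u s with h | h
    · rw [X.energy_of_le_start h]
      exact tx.total_nonneg u
    · rw [hX, Policy.cons_energy, Policy.empty_energy, hst, add_zero, min_eq_right h.le]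
      refine le_trans ?_ (tx.total_mono h.le)
      calc q * (min u (s + budget rx i) - s) ≤ q * budget rx i :=
            mul_le_mul_of_nonneg_left (by linarith [min_le_right u (s + budget rx i)]) hq0.le
        _ = tx.total s := div_mul_cancel₀ _ hΓ.ne'
  have hgle : g (tx.total t / budget rx i) ≤ g q :=
    hg.monotoneOn (div_nonneg (tx.total_nonneg t) hΓ.le) hq0.le
      (div_le_div_of_nonneg_right (tx.total_mono (le_max_right _ _)) hΓ.le)
  have hlen := hXN.onTime_finish
  rw [hXs, hXf] at hlen
  obtain ⟨Y, hY1, hY2, hY3, hY4, hY5, -⟩ := exists_noBreaks_of_policy tx hg hB₀ hs0 X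
    X.finish_nonneg (fun u _ => hXE u) (by rw [hXf]; linarith) (by
      rw [hXb]; exact ht.trans (mul_le_mul_of_nonneg_left hgle hΓ.le))
  refine ⟨Y, singleFeasible_of_noBreaks hY3 hY4 hY5 (hY1 ▸ le_max_left _ _) ?_⟩
  rw [hY1]
  linarith

/-- A rejected solution of `OFF(O_i)` is feasible in `OFF(O_{i+1})`. -/
theorem SolvesOFF.singleFeasible_succ (hg : IsRateFunction g) (hB₀ : 0 < B₀) {i : ℕ} {X : Policy}
    (hX : SolvesOFF tx rx g B₀ i X) (hrej : ¬ Accepts rx i X) :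
    SingleFeasible tx rx g B₀ (i + 1) X := by
  obtain ⟨hi, hlt⟩ := not_forall.1 hrej
  obtain ⟨⟨hF, -⟩, hN⟩ := hX
  exact singleFeasible_of_noBreaks hN hF.1 (fun t ht => by
      rcases le_total t 0 with h | h
      · rw [X.energy_of_le_start (h.trans X.start_nonneg)]
        exact tx.total_nonneg t
      · exact hF.energy_le ⟨h, ht⟩) (not_le.1 hlt).le
    ((hF.length_le hg hB₀ hN).trans (budget_mono rx hi i.le_succ))

theorem OFFMReaches.lt_count {i : ℕ} (h : OFFMReaches tx rx g B₀ i) : (i : ℕ∞) < rx.count := by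
  cases h with
  | init _ h => exact h.1.1
  | next _ _ _ _ h => exact (not_forall.1 h).choose

theorem OFFMReaches.exists_singleFeasible (hg : IsRateFunction g) (hB₀ : 0 < B₀) {i : ℕ}
    (h : OFFMReaches tx rx g B₀ i) : ∃ Q, SingleFeasible tx rx g B₀ i Q := by
  cases h with
  | init _ h => exact h.1.2.elim fun t ht => exists_singleFeasible_of_le hg hB₀ h.1.1 ht
  | next _ X _ hX h => exact ⟨X, hX.singleFeasible_succ hg hB₀ h⟩

/-- In the course of `OFFM`, the minimum finish time does not increase. -/
theorem OFFMReaches.exists_finish_le (hg : IsRateFunction g) (hB₀ : 0 < B₀) {i₀ : ℕ}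
    (hi₀ : IsInitialIndex tx rx g B₀ i₀) {i : ℕ} (h : OFFMReaches tx rx g B₀ i) :
    i₀ ≤ i ∧ ∀ k, i₀ ≤ k → k ≤ i → ∀ Y, SingleFeasible tx rx g B₀ k Y →
      ∃ Z, SingleFeasible tx rx g B₀ i Z ∧ Z.finish ≤ Y.finish := by
  induction h with
  | init j hj =>
    obtain rfl := hi₀.unique hj
    refine ⟨le_rfl, fun k h1 h2 Y hY => ?_⟩
    obtain rfl := le_antisymm h1 h2
    exact ⟨Y, hY, le_rfl⟩
  | next i X _ hX hrej ih =>
    refine ⟨ih.1.trans i.le_succ, fun k h1 h2 Y hY => ?_⟩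
    rcases h2.eq_or_lt with rfl | h2
    · exact ⟨Y, hY, le_rfl⟩
    · obtain ⟨Z, hZ, hZY⟩ := ih.2 k h1 (Nat.lt_succ_iff.1 h2) Y hY
      exact ⟨X, hX.singleFeasible_succ hg hB₀ hrej, (hX.1.2 Z hZ).trans hZY⟩

/-- A rejected solution starts after `O_{i+1} ≥ O_i`, hence uses all of `Γ(r_i)` and finishes after
`r_i`. Finish times stay below that of a fixed policy feasible in the first round, and only finitely
many arrivals come before it. -/
theorem exists_OFFMReaches_le (hg : IsRateFunction g) (hB₀ : 0 < B₀) {i₀ : ℕ}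
    (hi₀ : IsInitialIndex tx rx g B₀ i₀) : ∃ K : ℕ, ∀ i, OFFMReaches tx rx g B₀ i → i ≤ K := by
  obtain ⟨Y, hY⟩ := (OFFMReaches.init i₀ hi₀).exists_singleFeasible hg hB₀
  obtain ⟨K, hK⟩ := (rx.finite_le Y.finish).bddAbove
  refine ⟨max i₀ (K + 1), fun i hi => ?_⟩
  cases hi with
  | init _ h => exact (h.unique hi₀).le.trans (le_max_left _ _)
  | next i X hi hX hrej =>
    refine le_max_of_le_right (Nat.succ_le_succ (hK ⟨hi.lt_count, ?_⟩))
    obtain ⟨hi1, hlt⟩ := not_forall.1 hrej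
    have hOi := (origin_mono rx hi1 i.le_succ).trans_lt (not_le.1 hlt)
    obtain ⟨h1, h2⟩ := hi.exists_finish_le hg hB₀ hi₀
    obtain ⟨Z, hZ, hZY⟩ := h2 i₀ le_rfl h1 Y hY
    linarith [hX.1.2 Z hZ, hX.length_eq hg hB₀ hOi, time_le_origin_add rx hi.lt_count]

/-- A receiver sustainable from `O_i` is also sustainable from any later start; after `O_i + Γ(r_i)`
the harvested total already covers the whole budget. -/
theorem SolvesOFF.generalFeasible (hg : IsRateFunction g) (hB₀ : 0 < B₀) {i : ℕ}
    (hi : (i : ℕ∞) < rx.count) {X : Policy} (hX : SolvesOFF tx rx g B₀ i X) :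
    GeneralFeasible tx rx g B₀ X := by
  obtain ⟨⟨hF, -⟩, hN⟩ := hX
  have hO := hF.origin_le_start hg hB₀ hN
  refine ⟨hF.1, fun t ht => hF.energy_le ht, fun t ht => ?_⟩
  have hlen := hF.length_le hg hB₀ hN
  rcases le_or_gt t X.start with h | h
  · rw [X.onTime_of_le_start h]
    exact rx.total_nonneg t
  rw [hN.onTime_eq, min_eq_left ht.2, min_eq_right h.le]
  have hon := (isLeast_origin rx i hi).1.2
  rcases le_or_gt t (origin rx i + budget rx i) with h' | h'
  · linarith [hon t ⟨hO.trans h.le, h'⟩]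
  · linarith [hon _ ⟨by linarith [budget_pos rx hi], le_rfl⟩, rx.total_mono h'.le, ht.2]

/-- The competitor belongs to some `OFF(O_k)` with `k ≥ i₀`. For `k ≤ i` monotonicity of the minimum
finish times decides; for `k > i` the returned policy starts no later than `s` and lasts less than
`Q.finish - s`. -/
theorem OFFMReturns.isOptimal (hg : IsRateFunction g) (hB₀ : 0 < B₀) {i₀ : ℕ}
    (hi₀ : IsInitialIndex tx rx g B₀ i₀) {X : Policy} (hX : OFFMReturns tx rx g B₀ X) :
    X.IsOptimal (GeneralFeasible tx rx g B₀) := by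
  obtain ⟨i, hi, hX, hacc⟩ := hX
  refine ⟨hX.generalFeasible hg hB₀ hi.lt_count, fun Q hQ => ?_⟩
  obtain ⟨k, s, hk, hkB, hOs, hlen, Y, hY, hYQ⟩ := hQ.exists_singleFeasible hg hB₀
  rcases le_or_gt k i with hki | hik
  · obtain ⟨Z, hZ, hZY⟩ := (hi.exists_finish_le hg hB₀ hi₀).2 k (hi₀.2 ⟨hk, hkB⟩) hki Y hY
    exact (hX.1.2 Z hZ).trans (hZY.trans hYQ)
  · have h1 := hacc ((Nat.cast_le.2 (Nat.succ_le_of_lt hik)).trans_lt hk)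
    have h2 := origin_mono rx hk (Nat.succ_le_of_lt hik)
    have h3 := hX.1.1.length_le hg hB₀ hX.2
    linarith [hlen i hik]

end OFFM

/-- If the general problem is feasible, then `OFFM` is correct: the initial index exists, Step 1
can always be carried out, the number of rounds is bounded over all runs, some policy is returned,
and every returned policy is an optimal solution (without breaks) of the general problem. -/
theorem theorem3 (tx rx : Arrivals) (g : ℝ → ℝ) (hg : IsRateFunction g)
    (B₀ : ℝ) (hB₀ : 0 < B₀) (hfeas : ∃ P : Policy, GeneralFeasible tx rx g B₀ P) :
    (∃ i₀, IsInitialIndex tx rx g B₀ i₀) ∧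
    (∀ i, OFFMReaches tx rx g B₀ i → ∃ X, SolvesOFF tx rx g B₀ i X) ∧
    (∃ K : ℕ, ∀ i, OFFMReaches tx rx g B₀ i → i ≤ K) ∧
    (∃ X, OFFMReturns tx rx g B₀ X) ∧
    (∀ X, OFFMReturns tx rx g B₀ X →
      X.IsOptimal (GeneralFeasible tx rx g B₀) ∧ X.NoBreaks) := by
  classical
  obtain ⟨i₀, hi₀⟩ : ∃ i₀, IsInitialIndex tx rx g B₀ i₀ := by
    obtain ⟨P, hP⟩ := hfeas
    obtain ⟨k, -, hk, hkB, -⟩ := hP.exists_singleFeasible hg hB₀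
    have hex : ∃ i, i ∈ {i : ℕ | (i : ℕ∞) < rx.count ∧
      ∃ t : ℝ, B₀ ≤ budget rx i * g (tx.total t / budget rx i)} := ⟨k, hk, hkB⟩
    exact ⟨Nat.find hex, Nat.find_spec hex, fun j hj => Nat.find_min' hex hj⟩
  have hsolve : ∀ i, OFFMReaches tx rx g B₀ i → ∃ X, SolvesOFF tx rx g B₀ i X := fun i hi =>
    exists_solvesOFF hg hB₀ (hi.exists_singleFeasible hg hB₀)
  obtain ⟨K, hK⟩ := exists_OFFMReaches_le hg hB₀ hi₀
  refine ⟨⟨i₀, hi₀⟩, hsolve, ⟨K, hK⟩, ?_, fun X hX => ⟨hX.isOptimal hg hB₀ hi₀, ?_⟩⟩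
  -- Since the reached indices are bounded, some reached `i` has no successor round; any solution
  -- found there must be accepted.
  · obtain ⟨i, hi, hmax⟩ : ∃ i, OFFMReaches tx rx g B₀ i ∧ ¬ OFFMReaches tx rx g B₀ (i + 1) := by
      by_contra! hc
      have hall : ∀ n, OFFMReaches tx rx g B₀ (i₀ + n) := fun n => by
        induction n with
        | zero => exact .init i₀ hi₀
        | succ n ih => exact hc _ ih
      have := hK _ (hall (K + 1))
      omega
    obtain ⟨X, hX⟩ := hsolve i hi
    by_contra hc
    exact hmax (.next i X hi hX fun hacc => hc ⟨X, i, hi, hX, hacc⟩)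
  · obtain ⟨_, _, hX, _⟩ := hX
    exact hX.2
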